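/- Let $$\mathcal D=\quad\begin{array}{ccc}A'&\xrightarrow{\ v\ }&A\\ {\scriptstyle u'}\downarrow&&\downarrow{\scriptstyle u}\\ B'&\xrightarrow{\ w\ }&B\end{array}\qquad \alpha: uv\Rightarrow wu'$$ be a square in $\mathrm{Cat}$: $A,A',B,B'$ are small categories, $u,u',v,w$ are functors and $\alpha$ is a natural transformation (not necessarily invertible). Suppose that $u$ and $u'$ admit right adjoints. *Notation.* Let $W_\infty$ be the class of functors between small categories such that the topological realization of the induced map of nerves is a homotopy equivalence, and let $W_0$ be the class of those for which this realization induces a bijection on $\pi_0$. For $W\in\{W_\infty,W_0\}$, a functor $F:C\to D$ between small categories is *$W$-coaspherical* if for every object $d$ of $D$ the induced functor $d\backslash C\to d\backslash D$ is in $W$. The square $\mathcal D$ is *$W$-exact* if for every object $b'$ of $B'$ the functor $A'/b'\to A/w(b')$, $(a',\,g':u'(a')\to b')\mapsto (v(a'),\,w(g')\alpha_{a'})$, is $W$-coaspherical; $W_0$-exact squares are also called exact in the sense of Guitart. The square $\mathcal D$ is *left Beck–Chevalley* if $u$ and $u'$ admit right adjoints $r$ and $r'$ and the base change morphism $$vr'\xrightarrow{\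 \eta vr'\ }ruvr'\xrightarrow{\ r\alpha r'\ }rwu'r'\xrightarrow{\ rw\varepsilon'\ }rw$$ is an isomorphism, where $\eta$ is the unit of $u\dashv r$ and $\varepsilon'$ the counit of $u'\dashv r'$ (this does not depend on the choice of the adjunctions). For objects $a$ of $A$, $b'$ of $B'$ and a morphism $g:u(a)\to w(b')$ of $B$, let $A'_{(a,b',g)}$ be the category whose objects are the triples $(a',\,f:a\to v(a'),\,g':u'(a')\to b')$ with $a'$ an object of $A'$ and $w(g')\,\alpha_{a'}\,u(f)=g$, a morphism $(a'_1,f_1,g'_1)\to(a'_2,f_2,g'_2)$ being a morphism $h:a'_1\to a'_2$ of $A'$ with $v(h)f_1=f_2$ and $g'_2\,u'(h)=g'_1$. **Proposition.** Under these assumptions, the following conditions are equivalent: (a) $\mathcal D$ is left Beck–Chevalley; (b) $\mathcal D$ is $W_\infty$-exact; (c) $\mathcal D$ is $W_0$-exact; (d) for every object $a$ of $A$, the functor $a\backslash A'\to u(a)\backslash B'$, $(a',\,f:a\to v(a'))\mapsto(u'(a'),\,\alpha_{a'}u(f))$, admits a right adjoint; (e) for every object $a$ of $A$, every object $b'$ of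 $B'$ and every morphism $g:u(a)\to w(b')$ of $B$, the category $A'_{(a,b',g)}$ has a terminal object. -/

import Mathlib

open CategoryTheory

universe w

namespace ExactSquares

/-- A continuous map `f` is a homotopy equivalence. -/
def IsHomotopyEquivalence {X Y : Type w} [TopologicalSpace X] [TopologicalSpace Y]
    (f : C(X, Y)) : Prop :=
  ∃ e : ContinuousMap.HomotopyEquiv X Y, e.toFun = f

/-- The map `π₀(X) → π₀(Y)` induced by a continuous map `f : X → Y`. -/
def pi0Map {X Y : Type w} [TopologicalSpace X] [TopologicalSpace Y] (f : C(X, Y)) :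
    ZerothHomotopy X → ZerothHomotopy Y :=
  Quotient.map' f (fun _ _ h => h.map f.continuous)

/-- The topological realization of the nerve of a functor between small categories. -/
noncomputable def realization {C D : Cat.{w, w}} (F : C ⟶ D) :
    C(SSet.toTop.obj (nerveFunctor.obj C), SSet.toTop.obj (nerveFunctor.obj D)) :=
  (SSet.toTop.map (nerveFunctor.map F)).hom

/-- `W_∞`: the functors between small categories which the realization of the nerve sends to a
homotopy equivalence. -/
def WInf : MorphismProperty Cat.{w, w} :=
  fun _ _ F => IsHomotopyEquivalence (realization F)

/-- `W_0`: the functors between small categories which the realization of the nerve sends to a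
`0`-equivalence, that is, to a map inducing a bijection on `π₀`. -/
def WZero : MorphismProperty Cat.{w, w} :=
  fun _ _ F => Function.Bijective (pi0Map (realization F))

/-- A functor `F : C ⥤ D` is `W`-coaspherical if for every object `d` of `D` the functor
`d\C ⥤ d\D` induced by `F` is in `W`. -/
def IsCoaspherical (W : MorphismProperty Cat.{w, w}) {C D : Type w} [SmallCategory C]
    [SmallCategory D] (F : C ⥤ D) : Prop :=
  ∀ d : D, W (StructuredArrow.toUnder d F).toCatHom

section Square

variable {A A' B B' : Type w} [SmallCategory A] [SmallCategory A'] [SmallCategory B]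
  [SmallCategory B'] {u : A ⥤ B} {u' : A' ⥤ B'} {v : A' ⥤ A} {w : B' ⥤ B}

/-- A square `α : u v ⟶ w u'` is `W`-exact if for every object `b'` of `B'` the functor
`A'/b' ⥤ A/w(b')` induced by `v` and `α`, sending `(a', g' : u'(a') ⟶ b')` to
`(v(a'), w(g') ∘ α_{a'})`, is `W`-coaspherical. -/
def IsExact (W : MorphismProperty Cat.{w, w}) (α : TwoSquare v u' u w) : Prop :=
  ∀ b' : B', IsCoaspherical W (α.costructuredArrowRightwards b')

/-- A square `α : u v ⟶ w u'` is left Beck–Chevalley if `u` and `u'` have right adjoints `r` and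
`r'` and the base change morphism `v r' ⟶ r u v r' ⟶ r w u' r' ⟶ r w` (unit of `u ⊣ r`, then `α`,
then counit of `u' ⊣ r'`) is an isomorphism. -/
def IsLeftBeckChevalley (α : TwoSquare v u' u w) : Prop :=
  ∃ (r : B ⥤ A) (r' : B' ⥤ A') (adj : u ⊣ r) (adj' : u' ⊣ r'),
    IsIso (mateEquiv adj' adj α).natTrans

/-- The objects of the category `A'_{(a, b', g)}` : triples `(a', f, g')` where `a'` is an object
of `A'`, `f : a ⟶ v(a')` and `g' : u'(a') ⟶ b'`, such that `w(g') ∘ α_{a'} ∘ u(f) = g`. -/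
structure Factorization (α : TwoSquare v u' u w) {a : A} {b' : B'} (g : u.obj a ⟶ w.obj b') where
  pt : A'
  f : a ⟶ v.obj pt
  g' : u'.obj pt ⟶ b'
  fac : u.map f ≫ α.natTrans.app pt ≫ w.map g' = g

/-- The morphisms of `A'_{(a, b', g)}`. -/
@[ext]
structure Factorization.Hom {α : TwoSquare v u' u w} {a : A} {b' : B'} {g : u.obj a ⟶ w.obj b'}
    (X Y : Factorization α g) where
  hom : X.pt ⟶ Y.pt
  comm_f : X.f ≫ v.map hom = Y.f
  comm_g' : u'.map hom ≫ Y.g' = X.g'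

instance (α : TwoSquare v u' u w) {a : A} {b' : B'} (g : u.obj a ⟶ w.obj b') :
    Category (Factorization α g) where
  Hom X Y := Factorization.Hom X Y
  id X := ⟨𝟙 X.pt, by simp, by simp⟩
  comp p q := ⟨p.hom ≫ q.hom,
    by rw [v.map_comp, ← Category.assoc, p.comm_f, q.comm_f],
    by rw [u'.map_comp, Category.assoc, q.comm_g', p.comm_g']⟩
  id_comp p := Factorization.Hom.ext (Category.id_comp p.hom)
  comp_id p := Factorization.Hom.ext (Category.comp_id p.hom)
  assoc p q r := Factorization.Hom.ext (Category.assoc p.hom q.hom r.hom)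

end Square

end ExactSquares

/-! Fix a right adjoint `r'` of `u'`. Transposing `g'` turns a factorization of `g` into a morphism
`φ : a ⟶ v r' b'` with `transposition` equal to `g`. This `φ` is invariant under morphisms of
factorizations, and each factorization maps uniquely to the one that `ofHom` attaches to its `φ`. So
the components of `A'_{(a,b',g)}` correspond to the solutions `φ`, and a terminal object exists iff
the category is connected iff there is exactly one `φ`.

Up to the adjunction `u ⊣ r`, `transposition` is composition with the base change morphism, so (a) ↔
(e) is the Yoneda lemma. The comma categories that test (d) are again the `A'_{(a,b',g)}`.

Exactness compares `A'_{(a,b',g)}` with a coslice of `A/w(b')`, which has a terminal object because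
`u` has a right adjoint. A category with a terminal object has a contractible nerve, so (e) makes
both sides contractible and gives (b); conversely, a bijection on `π₀` already forces
`A'_{(a,b',g)}` to be connected. -/

namespace ExactSquares

/-! ### Base change and factorizations -/

section Transposition

variable {A A' B B' : Type w} [SmallCategory A] [SmallCategory A'] [SmallCategory B]
  [SmallCategory B'] {u : A ⥤ B} {u' : A' ⥤ B'} {v : A' ⥤ A} {w : B' ⥤ B}
  (α : TwoSquare v u' u w)

/-- The map `Hom(a, v r' b') → Hom(u a, w b')` induced by a square, for a right adjoint `r'` of
`u'`. -/
def transposition {r' : B' ⥤ A'} (adj' : u' ⊣ r') {a : A} {b' : B'}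
    (φ : a ⟶ v.obj (r'.obj b')) : u.obj a ⟶ w.obj b' :=
  u.map φ ≫ α.natTrans.app (r'.obj b') ≫ w.map (adj'.counit.app b')

/-- The counit of `u ⊣ r` cancels the unit occurring in the base change morphism. -/
lemma homEquiv_symm_comp_mateEquiv_app {r : B ⥤ A} {r' : B' ⥤ A'} (adj : u ⊣ r) (adj' : u' ⊣ r')
    {a : A} {b' : B'} (φ : a ⟶ v.obj (r'.obj b')) :
    (adj.homEquiv a (w.obj b')).symm (φ ≫ (mateEquiv adj' adj α).natTrans.app b') =
      transposition α adj' φ := by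
  rw [Adjunction.homEquiv_counit, Functor.map_comp, Category.assoc]
  exact congrArg (u.map φ ≫ ·) (mateEquiv_counit adj' adj α b')

lemma isIso_mateEquiv_iff {r : B ⥤ A} {r' : B' ⥤ A'} (adj : u ⊣ r) (adj' : u' ⊣ r') :
    IsIso (mateEquiv adj' adj α).natTrans ↔
      ∀ (a : A) (b' : B') (g : u.obj a ⟶ w.obj b'),
        ∃! φ : a ⟶ v.obj (r'.obj b'), transposition α adj' φ = g := by
  have key (a : A) (b' : B') (g : u.obj a ⟶ w.obj b') (φ : a ⟶ v.obj (r'.obj b')) :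
      transposition α adj' φ = g ↔
        φ ≫ (mateEquiv adj' adj α).natTrans.app b' = adj.homEquiv _ _ g := by
    rw [← homEquiv_symm_comp_mateEquiv_app α adj adj', Equiv.symm_apply_eq]
  simp_rw [key, NatTrans.isIso_iff_isIso_app]
  constructor
  · intro h a b' g
    have := h b'
    exact ⟨adj.homEquiv _ _ g ≫ inv ((mateEquiv adj' adj α).natTrans.app b'), by simp,
      fun φ hφ => (IsIso.eq_comp_inv _).2 hφ⟩
  · intro h b'
    rw [isIso_iff_yoneda_map_bijective]
    intro a
    rw [Function.bijective_iff_existsUnique]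
    intro f
    simpa using h a b' ((adj.homEquiv _ _).symm f)

variable {α}

namespace Factorization

variable {a : A} {b' : B'} {g : u.obj a ⟶ w.obj b'} {r' : B' ⥤ A'} (adj' : u' ⊣ r')

/-- The morphism `a ⟶ v r' b'` underlying a factorization of `g : u a ⟶ w b'`. -/
def toHom (X : Factorization α g) : a ⟶ v.obj (r'.obj b') :=
  X.f ≫ v.map (adj'.homEquiv _ _ X.g')

lemma transposition_toHom (X : Factorization α g) : transposition α adj' (X.toHom adj') = g := by
  have h := α.natTrans.naturality (adj'.homEquiv _ _ X.g')
  dsimp at h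
  have h' : u'.map (adj'.homEquiv _ _ X.g') ≫ adj'.counit.app b' = X.g' := by
    simp [Adjunction.homEquiv_unit]
  rw [transposition, toHom, Functor.map_comp, Category.assoc, reassoc_of% h, ← w.map_comp, h',
    X.fac]

/-- This makes `toHom` a function on connected components. -/
lemma toHom_eq_of_hom {X Y : Factorization α g} (p : X ⟶ Y) : X.toHom adj' = Y.toHom adj' := by
  have h : p.hom ≫ adj'.homEquiv _ _ Y.g' = adj'.homEquiv _ _ X.g' := by
    rw [← Adjunction.homEquiv_naturality_left, p.comm_g']
  rw [toHom, toHom, ← p.comm_f, Category.assoc, ← v.map_comp, h]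

/-- The factorization of `g` through `r' b'` associated to a morphism `a ⟶ v r' b'` whose
transposition is `g`. -/
@[simps]
def ofHom (φ : a ⟶ v.obj (r'.obj b')) (h : transposition α adj' φ = g) : Factorization α g where
  pt := r'.obj b'
  f := φ
  g' := adj'.counit.app b'
  fac := h

lemma toHom_ofHom (φ : a ⟶ v.obj (r'.obj b')) (h : transposition α adj' φ = g) :
    (ofHom adj' φ h).toHom adj' = φ := by
  change φ ≫ v.map (adj'.homEquiv (r'.obj b') b' (adj'.counit.app b')) = φ
  rw [Adjunction.homEquiv_unit, adj'.right_triangle_components, v.map_id, Category.comp_id]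

/-- The factorization attached to the only morphism `a ⟶ v r' b'` with transposition `g` is
terminal. -/
def isTerminalOfHom (φ : a ⟶ v.obj (r'.obj b')) (h : transposition α adj' φ = g)
    (hφ : ∀ ψ, transposition α adj' ψ = g → ψ = φ) : Limits.IsTerminal (ofHom adj' φ h) :=
  Limits.IsTerminal.ofUniqueHom
    (fun X => ⟨adj'.homEquiv _ _ X.g', hφ _ (X.transposition_toHom adj'),
      (adj'.homEquiv_counit _ _ _).symm.trans (Equiv.symm_apply_apply _ _)⟩)
    (fun X p => Hom.ext (((adj'.homEquiv X.pt b').symm_apply_eq).1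
      ((adj'.homEquiv_counit _ _ p.hom).trans p.comm_g')))

/-- Every solution `ψ` is the `toHom` of `ofHom ψ`, so a constant `toHom` leaves only one solution.
-/
lemma hasTerminal_of_toHom_eq [Nonempty (Factorization α g)]
    (h : ∀ X Y : Factorization α g, X.toHom adj' = Y.toHom adj') :
    Limits.HasTerminal (Factorization α g) := by
  obtain ⟨X⟩ := ‹Nonempty (Factorization α g)›
  refine (isTerminalOfHom adj' _ (X.transposition_toHom adj') fun ψ hψ => ?_).hasTerminal
  rw [← toHom_ofHom adj' ψ hψ]
  exact h _ _

lemma hasTerminal_iff :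
    Limits.HasTerminal (Factorization α g) ↔
      ∃! φ : a ⟶ v.obj (r'.obj b'), transposition α adj' φ = g := by
  constructor
  · intro _
    refine ⟨(⊤_ (Factorization α g)).toHom adj', transposition_toHom adj' _, fun φ hφ => ?_⟩
    rw [← toHom_ofHom adj' φ hφ]
    exact toHom_eq_of_hom adj' (Limits.terminal.from _)
  · rintro ⟨φ, hφ, h⟩
    exact (isTerminalOfHom adj' φ hφ h).hasTerminal

variable (α g)

/-- The category of factorizations of `g` is a category of structured arrows. -/
def equivalenceStructuredArrow : Factorization α g ≌ α.StructuredArrowRightwards g where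
  functor :=
    { obj X := TwoSquare.StructuredArrowRightwards.mk α g X.pt X.f X.g' X.fac
      map p := StructuredArrow.homMk (CostructuredArrow.homMk p.hom p.comm_g')
        (by ext; exact p.comm_f) }
  inverse :=
    { obj X := ⟨X.right.left, X.hom.left, X.right.hom, CostructuredArrow.w X.hom⟩
      map p := ⟨p.right.left, by rw [← StructuredArrow.w p]; rfl, CostructuredArrow.w p.right⟩ }
  unitIso := Iso.refl _
  counitIso := Iso.refl _
  functor_unitIso_comp _ := by
    ext
    exact Category.comp_id _

end Factorization

end Transposition

/-! ### Maps out of a geometric realization -/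

section Realization

open Opposite Simplicial

/-- The characteristic map of a simplex of a simplicial set. -/
noncomputable def characteristicMap {X : SSet.{w}} {n : SimplexCategory} (x : X.obj (op n)) :
    C(stdSimplex ℝ (Fin (n.len + 1)), SSet.toTop.obj X) :=
  TopCat.toSSetObjEquiv _ _ ((sSetTopAdj.unit.app X).app (op n) x)

lemma characteristicMap_map {X : SSet.{w}} {n m : SimplexCategory} (f : n ⟶ m) (x : X.obj (op m))
    (z : stdSimplex ℝ (Fin (n.len + 1))) :
    characteristicMap (X.map f.op x) z = characteristicMap x (stdSimplex.map f z) := by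
  have h := NatTrans.naturality_apply (sSetTopAdj.unit.app X) f.op x
  dsimp at h
  rw [characteristicMap, h]
  rfl

/-- Continuous maps from a realization are determined by their composites with the
characteristic maps of the simplices. -/
lemma realization_hom_ext {X : SSet.{w}} {T : TopCat.{w}} {f g : C(SSet.toTop.obj X, T)}
    (h : ∀ (n : SimplexCategory) (x : X.obj (op n)) (z : stdSimplex ℝ (Fin (n.len + 1))),
      f (characteristicMap x z) = g (characteristicMap x z)) : f = g := by
  have : TopCat.ofHom f = TopCat.ofHom g := by
    apply (sSetTopAdj.homEquiv _ _).injective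
    ext n x
    apply (TopCat.toSSetObjEquiv _ _).injective
    ext z
    exact h n.unop x z
  exact congrArg TopCat.Hom.hom this

/-- A continuous map from a realization, constructed from a compatible family of maps from
standard simplices. -/
lemma exists_realization_desc {X : SSet.{w}} {T : Type w} [TopologicalSpace T]
    (φ : ∀ (n : SimplexCategory) (_ : X.obj (op n)), C(stdSimplex ℝ (Fin (n.len + 1)), T))
    (hφ : ∀ (n m : SimplexCategory) (f : n ⟶ m) (x : X.obj (op m))
      (z : stdSimplex ℝ (Fin (n.len + 1))), φ n (X.map f.op x) z = φ m x (stdSimplex.map f z)) :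
    ∃ F : C(SSet.toTop.obj X, T), ∀ (n : SimplexCategory) (x : X.obj (op n))
      (z : stdSimplex ℝ (Fin (n.len + 1))), F (characteristicMap x z) = φ n x z := by
  let m : X ⟶ TopCat.toSSet.obj (TopCat.of T) :=
    { app n := ↾fun x => (TopCat.toSSetObjEquiv (TopCat.of T) n).symm (φ n.unop x)
      naturality := by
        intro n k f
        ext x
        apply (TopCat.toSSetObjEquiv _ _).injective
        ext z
        exact hφ _ _ f.unop x z }
  refine ⟨((sSetTopAdj.homEquiv _ _).symm m).hom, fun n x z => ?_⟩
  have h := congrArg (fun t => t.app (op n) x) ((sSetTopAdj.homEquiv _ _).apply_symm_apply m)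
  rw [Adjunction.homEquiv_unit] at h
  exact DFunLike.congr_fun (congrArg (TopCat.toSSetObjEquiv _ _) h) z

end Realization

/-! ### Coning off simplices with a terminal object -/

section Cone

open Opposite Simplicial

/-- The order preserving map `[m + 1] ⟶ [n + 1]` extending `f : [m] ⟶ [n]` and preserving the last
element. -/
def extendLast {m n : SimplexCategory} (f : m ⟶ n) :
    (⦋m.len + 1⦌ : SimplexCategory) ⟶ ⦋n.len + 1⦌ :=
  SimplexCategory.Hom.mk
    { toFun := Fin.lastCases (Fin.last _) (fun i => (f i).castSucc)
      monotone' := by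
        intro i j h
        induction j using Fin.lastCases with
        | last => simpa using Fin.le_last _
        | cast j =>
          induction i using Fin.lastCases with
          | last => exact absurd h (by simp)
          | cast i =>
            simpa using show f i ≤ f j from f.toOrderHom.monotone (by simpa using h) }

lemma extendLast_castSucc {m n : SimplexCategory} (f : m ⟶ n) (i : Fin (m.len + 1)) :
    extendLast f i.castSucc = (f i).castSucc :=
  Fin.lastCases_castSucc (motive := fun _ => Fin (n.len + 2)) (last := Fin.last _)
    (cast := fun i => (f i).castSucc) i

lemma extendLast_last {m n : SimplexCategory} (f : m ⟶ n) :
    extendLast f (Fin.last _) = Fin.last _ :=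
  Fin.lastCases_last (motive := fun _ => Fin (n.len + 2)) (last := Fin.last _)
    (cast := fun i => (f i).castSucc)

instance (P : Type*) [Category* P] [Quiver.IsThin P] : Quiver.IsThin (WithTerminal P) := by
  rintro (_ | _) (_ | _)
  · exact ⟨fun p q => Subsingleton.elim (WithTerminal.down p) (WithTerminal.down q)⟩
  · exact inferInstanceAs (Subsingleton PUnit)
  · exact inferInstanceAs (Subsingleton PEmpty)
  · exact inferInstanceAs (Subsingleton PUnit)

/-- The functor `[n + 1] ⥤ [n]^▹` sending the last element to the adjoined terminal object. -/
noncomputable def lastToStar (n : ℕ) : Fin (n + 2) ⥤ WithTerminal (Fin (n + 1)) where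
  obj := Fin.lastCases WithTerminal.star WithTerminal.of
  map {i j} h := Nonempty.some (by
    induction j using Fin.lastCases with
    | last => rw [Fin.lastCases_last]; exact ⟨WithTerminal.starTerminal.from _⟩
    | cast j =>
      induction i using Fin.lastCases with
      | last => exact absurd h.le (by simp)
      | cast i =>
        rw [Fin.lastCases_castSucc, Fin.lastCases_castSucc]
        exact ⟨WithTerminal.incl.map (homOfLE (by simpa using h.le))⟩)
  map_id _ := Subsingleton.elim _ _
  map_comp _ _ := Subsingleton.elim _ _

lemma lastToStar_obj_castSucc {n : ℕ} (i : Fin (n + 1)) :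
    (lastToStar n).obj i.castSucc = WithTerminal.of i :=
  Fin.lastCases_castSucc (motive := fun _ => WithTerminal (Fin (n + 1))) i

lemma lastToStar_obj_last (n : ℕ) :
    (lastToStar n).obj (Fin.last _) = WithTerminal.star :=
  Fin.lastCases_last (motive := fun _ => WithTerminal (Fin (n + 1)))

lemma functor_ext_of_isThin {P Q : Type*} [Category* P] [Category* Q] [Quiver.IsThin Q]
    {F G : P ⥤ Q} (h : ∀ i, F.obj i = G.obj i) : F = G :=
  CategoryTheory.Functor.ext h (fun _ _ _ => Subsingleton.elim _ _)

variable {C : Type w} [SmallCategory C] {t : C} (ht : Limits.IsTerminal t)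

/-- The simplex of the nerve of a category obtained by appending a terminal object. -/
noncomputable def coneSimplex {n : SimplexCategory} (x : (nerve C).obj (op n)) :
    (nerve C).obj (op ⦋n.len + 1⦌) :=
  (lastToStar n.len ⋙ WithTerminal.liftToTerminal x ht : Fin (n.len + 2) ⥤ C)

/-- Appending `t` commutes with simplicial operators once these are extended to fix the last vertex;
this is what lets the homotopies on simplices glue. -/
lemma coneSimplex_map {m n : SimplexCategory} (f : m ⟶ n) (x : (nerve C).obj (op n)) :
    coneSimplex ht ((nerve C).map f.op x) = (nerve C).map (extendLast f).op (coneSimplex ht x) := by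
  have h₁ : (SimplexCategory.toCat.map (extendLast f)).toFunctor ⋙ lastToStar n.len =
      lastToStar m.len ⋙ WithTerminal.map (SimplexCategory.toCat.map f).toFunctor := by
    refine functor_ext_of_isThin fun i => ?_
    change (lastToStar n.len).obj (extendLast f i) = _
    induction i using Fin.lastCases with
    | last =>
      rw [extendLast_last, lastToStar_obj_last]
      exact congrArg (WithTerminal.map (SimplexCategory.toCat.map f).toFunctor).obj
        (lastToStar_obj_last m.len).symm
    | cast i =>
      rw [extendLast_castSucc, lastToStar_obj_castSucc]
      exact congrArg (WithTerminal.map (SimplexCategory.toCat.map f).toFunctor).obj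
        (lastToStar_obj_castSucc i).symm
  have h₂ (F : Fin (m.len + 1) ⥤ Fin (n.len + 1)) (G : Fin (n.len + 1) ⥤ C) :
      WithTerminal.map F ⋙ WithTerminal.liftToTerminal G ht =
        WithTerminal.liftToTerminal (F ⋙ G) ht := by
    refine Functor.hext (by rintro (_ | _) <;> rfl) ?_
    rintro (_ | _) (_ | _) p
    · rfl
    · rfl
    · exact (WithTerminal.false_of_from_star p).elim
    · rfl
  exact ((congrArg (· ⋙ WithTerminal.liftToTerminal x ht) h₁).trans
    (congrArg (lastToStar m.len ⋙ ·) (h₂ _ x))).symm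

/-- The inclusion of `[n]` as the face of `[n + 1]` opposite to the last vertex. -/
def lastFace (n : SimplexCategory) : n ⟶ (⦋n.len + 1⦌ : SimplexCategory) :=
  SimplexCategory.Hom.mk Fin.castSuccOrderEmb.toOrderHom

lemma map_lastFace_coneSimplex {n : SimplexCategory} (x : (nerve C).obj (op n)) :
    (nerve C).map (lastFace n).op (coneSimplex ht x) = x := by
  have h : (SimplexCategory.toCat.map (lastFace n)).toFunctor ⋙ lastToStar n.len =
      WithTerminal.incl :=
    functor_ext_of_isThin fun i => lastToStar_obj_castSucc i
  exact congrArg (· ⋙ WithTerminal.liftToTerminal x ht) h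

/-- The last vertex of `[n + 1]`. -/
def lastVertex (n : SimplexCategory) : ⦋0⦌ ⟶ (⦋n.len + 1⦌ : SimplexCategory) :=
  SimplexCategory.const _ _ (Fin.last _)

lemma map_lastVertex_coneSimplex {n : SimplexCategory} (x : (nerve C).obj (op n)) :
    (nerve C).map (lastVertex n).op (coneSimplex ht x) = nerveEquiv.symm t := by
  refine nerveEquiv.injective ?_
  rw [Equiv.apply_symm_apply]
  change (WithTerminal.liftToTerminal x ht).obj ((lastToStar n.len).obj (Fin.last _)) = t
  rw [lastToStar_obj_last]
  rfl

end Cone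

/-! ### Straight-line contraction to the last vertex -/

section Interpolation

variable {n : ℕ}

/-- The point of the `(n + 1)`-simplex at time `s` on the segment from a point of the face opposite
to the last vertex to this vertex. -/
noncomputable def interpolate (z : stdSimplex ℝ (Fin (n + 1))) (s : unitInterval) :
    stdSimplex ℝ (Fin (n + 2)) :=
  ⟨(1 - s : ℝ) • (stdSimplex.map Fin.castSucc z).1 + (s : ℝ) • (stdSimplex.vertex (Fin.last _)).1,
    convex_stdSimplex ℝ _ (stdSimplex.map Fin.castSucc z).2 (stdSimplex.vertex (Fin.last _)).2
      (sub_nonneg.2 s.2.2) s.2.1 (sub_add_cancel _ _)⟩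

lemma continuous_interpolate :
    Continuous fun p : stdSimplex ℝ (Fin (n + 1)) × unitInterval => interpolate p.1 p.2 := by
  have := stdSimplex.continuous_map (S := ℝ) (Fin.castSucc (n := n + 1))
  unfold interpolate
  fun_prop

@[simp]
lemma interpolate_zero (z : stdSimplex ℝ (Fin (n + 1))) :
    interpolate z 0 = stdSimplex.map Fin.castSucc z :=
  Subtype.ext (by simp [interpolate])

@[simp]
lemma interpolate_one (z : stdSimplex ℝ (Fin (n + 1))) :
    interpolate z 1 = stdSimplex.vertex (Fin.last _) :=
  Subtype.ext (by simp [interpolate])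

lemma map_interpolate {m : ℕ} (f : Fin (m + 1) → Fin (n + 1)) (f' : Fin (m + 2) → Fin (n + 2))
    (hf : ∀ i, f' i.castSucc = (f i).castSucc) (hf' : f' (Fin.last _) = Fin.last _)
    (z : stdSimplex ℝ (Fin (m + 1))) (s : unitInterval) :
    stdSimplex.map f' (interpolate z s) = interpolate (stdSimplex.map f z) s := by
  have h₁ : stdSimplex.map f' (stdSimplex.map Fin.castSucc z) =
      stdSimplex.map Fin.castSucc (stdSimplex.map f z) := by
    rw [stdSimplex.map_comp_apply, stdSimplex.map_comp_apply]
    exact congrArg (fun k => stdSimplex.map k z) (funext hf)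
  have h₂ : stdSimplex.map (S := ℝ) f' (stdSimplex.vertex (Fin.last _)) =
      stdSimplex.vertex (Fin.last _) := by
    rw [stdSimplex.map_vertex, hf']
  apply Subtype.ext
  change FunOnFinite.linearMap ℝ ℝ f' (_ + _) = (1 - s : ℝ) • _ + (s : ℝ) • _
  rw [map_add, map_smul, map_smul, ← h₁, ← h₂]
  rfl

end Interpolation

/-! ### Contractibility of the nerve -/

section Contraction

open Opposite Simplicial

variable (C : Type w) [SmallCategory C]

/-- Each simplex slides inside its cone towards the vertex `⊤_ C`. -/
theorem contractibleSpace_nerve_of_hasTerminal [Limits.HasTerminal C] :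
    ContractibleSpace (SSet.toTop.obj (nerve C)) := by
  have ht : Limits.IsTerminal (⊤_ C) := Limits.terminalIsTerminal
  -- Gluing into the path space `C(unitInterval, _)` avoids describing the product of the
  -- realization with the interval.
  obtain ⟨F, hF⟩ := exists_realization_desc (X := nerve C)
    (T := C(unitInterval, SSet.toTop.obj (nerve C)))
    (fun n x => ContinuousMap.curry ((characteristicMap (coneSimplex ht x)).comp
      ⟨fun p : stdSimplex ℝ (Fin (n.len + 1)) × unitInterval => interpolate p.1 p.2,
        continuous_interpolate⟩))
    (by
      intro n m f x z
      ext s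
      change characteristicMap _ (interpolate z s) = characteristicMap _ (interpolate _ s)
      rw [coneSimplex_map, characteristicMap_map]
      exact congrArg _ (map_interpolate _ _ (extendLast_castSucc f) (extendLast_last f) z s))
  rw [contractible_iff_id_nullhomotopic]
  refine ⟨characteristicMap (n := ⦋0⦌) (nerveEquiv.symm (⊤_ C)) default, ⟨?_⟩⟩
  have h₀ : (⟨fun x => F x 0, by fun_prop⟩ : C(|nerve C|, |nerve C|)) =
      ContinuousMap.id _ := by
    refine realization_hom_ext (T := SSet.toTop.obj (nerve C)) fun n x z => ?_
    change F (characteristicMap x z) 0 = characteristicMap x z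
    rw [hF]
    change characteristicMap (coneSimplex ht x) (interpolate z 0) = _
    conv_rhs => rw [← map_lastFace_coneSimplex ht x, characteristicMap_map]
    rw [interpolate_zero]
    rfl
  have h₁ : (⟨fun x => F x 1, by fun_prop⟩ : C(|nerve C|, |nerve C|)) =
      ContinuousMap.const _ (characteristicMap (n := ⦋0⦌) (nerveEquiv.symm (⊤_ C)) default) := by
    refine realization_hom_ext (T := SSet.toTop.obj (nerve C)) fun n x z => ?_
    change F (characteristicMap x z) 1 = _
    rw [hF]
    change characteristicMap (coneSimplex ht x) (interpolate z 1) = _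
    rw [← map_lastVertex_coneSimplex ht x, characteristicMap_map, interpolate_one]
    rw [Subsingleton.elim default (stdSimplex.vertex (0 : Fin 1)), stdSimplex.map_vertex]
    rfl
  exact
    { toFun p := F p.2 p.1
      continuous_toFun := by fun_prop
      map_zero_left x := DFunLike.congr_fun h₀ x
      map_one_left x := DFunLike.congr_fun h₁ x }

end Contraction

/-! ### Connected components of the nerve -/

section PiZero

variable {C : Type w} [SmallCategory C]

open Opposite Simplicial

/-- A function on the objects of a category which is invariant along morphisms extends to a locally
constant function on the realization of the nerve. -/
lemma exists_realization_locallyConstant {S : Type w} [TopologicalSpace S] [DiscreteTopology S]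
    (φ : C → S) (hφ : ∀ {x y : C} (_ : x ⟶ y), φ x = φ y) :
    ∃ F : C(SSet.toTop.obj (nerve C), S), ∀ x : C,
      F (characteristicMap (n := ⦋0⦌) (nerveEquiv.symm x) default) = φ x := by
  obtain ⟨F, hF⟩ := exists_realization_desc (X := nerve C) (T := S)
    (fun n (x : Fin (n.len + 1) ⥤ C) => ContinuousMap.const _ (φ (x.obj 0)))
    (fun n m f (x : Fin (m.len + 1) ⥤ C) z =>
      -- The operator `f` may move vertex `0`; the edge from `0` to `f 0` shows that the value is
      -- unchanged.
      (hφ (x.map (homOfLE (Fin.zero_le (f.toOrderHom 0))))).symm)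
  exact ⟨F, fun x => hF ⦋0⦌ (nerveEquiv.symm x) default⟩

lemma nonempty_of_nonempty_realization [h : Nonempty (SSet.toTop.obj (nerve C))] : Nonempty C := by
  by_contra hC
  obtain ⟨F, -⟩ := exists_realization_locallyConstant (C := C) (S := PEmpty)
    (fun x => (hC ⟨x⟩).elim) (fun {x} => (hC ⟨x⟩).elim)
  exact (F h.some).elim

lemma eq_of_subsingleton_zerothHomotopy
    [Subsingleton (ZerothHomotopy (SSet.toTop.obj (nerve C)))] {S : Type w}
    (φ : C → S) (hφ : ∀ {x y : C} (_ : x ⟶ y), φ x = φ y) (x y : C) : φ x = φ y := by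
  let _ : TopologicalSpace S := ⊥
  have : DiscreteTopology S := ⟨rfl⟩
  obtain ⟨F, hF⟩ := exists_realization_locallyConstant φ hφ
  obtain ⟨p⟩ : Joined (characteristicMap (n := ⦋0⦌) (nerveEquiv.symm x) default)
      (characteristicMap (n := ⦋0⦌) (nerveEquiv.symm y) default) :=
    Quotient.exact (Subsingleton.elim (α := ZerothHomotopy (SSet.toTop.obj (nerve C))) _ _)
  -- A path in a discrete space is constant.
  have h := (p.map F.continuous).source.symm.trans <|
    (PreconnectedSpace.constant inferInstance (p.map F.continuous).continuous).trans
      (p.map F.continuous).target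
  rwa [hF, hF] at h

end PiZero

/-! ### Comparison of `WInf` and `WZero` -/

section Equivalences

lemma isHomotopyEquivalence_of_contractibleSpace {X Y : Type w} [TopologicalSpace X]
    [TopologicalSpace Y] [ContractibleSpace X] [ContractibleSpace Y] (f : C(X, Y)) :
    IsHomotopyEquivalence f := by
  obtain ⟨e⟩ := ContractibleSpace.hequiv X Y
  have homotopic_of_target {Z T : Type w} [TopologicalSpace Z] [TopologicalSpace T]
      [ContractibleSpace T] (k l : C(Z, T)) : k.Homotopic l := by
    obtain ⟨y, hy⟩ := id_nullhomotopic T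
    exact (hy.comp (ContinuousMap.Homotopic.refl k)).trans
      (hy.comp (ContinuousMap.Homotopic.refl l)).symm
  exact ⟨⟨f, e.invFun, homotopic_of_target _ _, homotopic_of_target _ _⟩, rfl⟩

lemma pi0Map_comp {X Y Z : Type w} [TopologicalSpace X] [TopologicalSpace Y] [TopologicalSpace Z]
    (f : C(X, Y)) (g : C(Y, Z)) : pi0Map (g.comp f) = pi0Map g ∘ pi0Map f := by
  ext ⟨x⟩
  rfl

lemma pi0Map_id (X : Type w) [TopologicalSpace X] : pi0Map (ContinuousMap.id X) = id := by
  ext ⟨x⟩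
  rfl

lemma pi0Map_eq_of_homotopic {X Y : Type w} [TopologicalSpace X] [TopologicalSpace Y]
    {f g : C(X, Y)} (h : f.Homotopic g) : pi0Map f = pi0Map g := by
  obtain ⟨H⟩ := h
  ext ⟨x⟩
  exact Quotient.sound ⟨H.evalAt x⟩

lemma IsHomotopyEquivalence.bijective_pi0Map {X Y : Type w} [TopologicalSpace X]
    [TopologicalSpace Y] {f : C(X, Y)} (hf : IsHomotopyEquivalence f) :
    Function.Bijective (pi0Map f) := by
  obtain ⟨e, rfl⟩ := hf
  refine Function.bijective_iff_has_inverse.2 ⟨pi0Map e.invFun, fun x => ?_, fun y => ?_⟩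
  · exact congrFun (((pi0Map_comp _ _).symm.trans (pi0Map_eq_of_homotopic e.left_inv)).trans
      (pi0Map_id X)) x
  · exact congrFun (((pi0Map_comp _ _).symm.trans (pi0Map_eq_of_homotopic e.right_inv)).trans
      (pi0Map_id Y)) y

lemma WInf_le_WZero : WInf.{w} ≤ WZero :=
  fun _ _ _ hF => hF.bijective_pi0Map

lemma wInf_of_hasTerminal {C D : Type w} [SmallCategory C] [SmallCategory D]
    [Limits.HasTerminal C] [Limits.HasTerminal D] (F : C ⥤ D) : WInf F.toCatHom := by
  have := contractibleSpace_nerve_of_hasTerminal C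
  have := contractibleSpace_nerve_of_hasTerminal D
  exact isHomotopyEquivalence_of_contractibleSpace
    (X := SSet.toTop.obj (nerve C)) (Y := SSet.toTop.obj (nerve D)) _

lemma IsExact.mono {A A' B B' : Type w} [SmallCategory A] [SmallCategory A'] [SmallCategory B]
    [SmallCategory B'] {u : A ⥤ B} {u' : A' ⥤ B'} {v : A' ⥤ A} {w : B' ⥤ B}
    {α : TwoSquare v u' u w} {W W' : MorphismProperty Cat.{w, w}} (hW : W ≤ W')
    (h : IsExact W α) : IsExact W' α :=
  fun b' d => hW _ (h b' d)

end Equivalences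

/-! ### The equivalences for a square -/

section Square

variable {A A' B B' : Type w} [SmallCategory A] [SmallCategory A'] [SmallCategory B]
  [SmallCategory B'] {u : A ⥤ B} {u' : A' ⥤ B'} {v : A' ⥤ A} {w : B' ⥤ B}
  {α : TwoSquare v u' u w}

lemma hasTerminal_of_equivalence {C D : Type*} [Category* C] [Category* D] (e : C ≌ D)
    [Limits.HasTerminal C] : Limits.HasTerminal D :=
  Adjunction.hasLimitsOfShape_of_equivalence e.inverse

/-- A right adjoint gives `F/d` a terminal object, and the arrow from `X` to it is terminal in the
coslice. -/
lemma hasTerminal_under_costructuredArrow {C D : Type*} [Category* C] [Category* D] {F : C ⥤ D}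
    (hF : F.IsLeftAdjoint) {d : D} (X : CostructuredArrow F d) : Limits.HasTerminal (Under X) := by
  have := isLeftAdjoint_iff_hasTerminal_costructuredArrow.1 hF d
  exact (Limits.IsTerminal.ofUniqueHom (Y := Under.mk (Limits.terminal.from X))
    (fun Y => Under.homMk (Limits.terminal.from _) (Limits.terminal.hom_ext _ _))
    (fun Y f => by ext1; exact Limits.terminal.hom_ext _ _)).hasTerminal

lemma isExact_wInf_of_hasTerminal (hu : u.IsLeftAdjoint)
    (h : ∀ (a : A) (b' : B') (g : u.obj a ⟶ w.obj b'), Limits.HasTerminal (Factorization α g)) :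
    IsExact WInf.{w} α := by
  intro b' d
  have := hasTerminal_under_costructuredArrow hu d
  have := h d.left b' d.hom
  have : Limits.HasTerminal (StructuredArrow d (α.costructuredArrowRightwards b')) :=
    hasTerminal_of_equivalence (Factorization.equivalenceStructuredArrow α d.hom)
  exact wInf_of_hasTerminal _

lemma hasTerminal_of_isExact_wZero (hu : u.IsLeftAdjoint) (hu' : u'.IsLeftAdjoint)
    (h : IsExact WZero.{w} α) (a : A) (b' : B') (g : u.obj a ⟶ w.obj b') :
    Limits.HasTerminal (Factorization α g) := by
  obtain ⟨r', ⟨adj'⟩⟩ := hu'.exists_rightAdjoint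
  let e := Factorization.equivalenceStructuredArrow α g
  have bij : Function.Bijective (pi0Map
      (X := SSet.toTop.obj (nerve (α.StructuredArrowRightwards g)))
      (Y := SSet.toTop.obj (nerve (Under (CostructuredArrow.mk g))))
      (realization (StructuredArrow.toUnder (CostructuredArrow.mk g)
        (α.costructuredArrowRightwards b')).toCatHom)) := h b' (CostructuredArrow.mk g)
  have := hasTerminal_under_costructuredArrow hu (CostructuredArrow.mk g)
  have := contractibleSpace_nerve_of_hasTerminal (Under (CostructuredArrow.mk g))
  have : Subsingleton (ZerothHomotopy (SSet.toTop.obj (nerve (Under (CostructuredArrow.mk g))))) :=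
    (pathConnectedSpace_iff_zerothHomotopy.1 inferInstance).2
  have : Subsingleton (ZerothHomotopy (SSet.toTop.obj (nerve (α.StructuredArrowRightwards g)))) :=
    bij.1.subsingleton
  obtain ⟨⟨x⟩, -⟩ := bij.2 (Quotient.mk _
    (Classical.arbitrary (SSet.toTop.obj (nerve (Under (CostructuredArrow.mk g))))))
  have : Nonempty (SSet.toTop.obj (nerve (α.StructuredArrowRightwards g))) := ⟨x⟩
  obtain ⟨x₀⟩ := nonempty_of_nonempty_realization (C := α.StructuredArrowRightwards g)
  have : Nonempty (Factorization α g) := ⟨e.inverse.obj x₀⟩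
  -- Since the unit of `e` is the identity, `e.inverse` sends `e.functor.obj X` back to `X`
  -- definitionally.
  exact Factorization.hasTerminal_of_toHom_eq adj' fun X Y =>
    eq_of_subsingleton_zerothHomotopy (C := α.StructuredArrowRightwards g)
      (fun Z => (e.inverse.obj Z).toHom adj')
      (fun p => Factorization.toHom_eq_of_hom adj' (e.inverse.map p))
      (e.functor.obj X) (e.functor.obj Y)

lemma isLeftBeckChevalley_iff (hu : u.IsLeftAdjoint) (hu' : u'.IsLeftAdjoint) :
    IsLeftBeckChevalley α ↔
      ∀ (a : A) (b' : B') (g : u.obj a ⟶ w.obj b'), Limits.HasTerminal (Factorization α g) := by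
  constructor
  · rintro ⟨r, r', adj, adj', h⟩ a b' g
    exact (Factorization.hasTerminal_iff adj').2 ((isIso_mateEquiv_iff α adj adj').1 h a b' g)
  · intro h
    obtain ⟨r, ⟨adj⟩⟩ := hu.exists_rightAdjoint
    obtain ⟨r', ⟨adj'⟩⟩ := hu'.exists_rightAdjoint
    exact ⟨r, r', adj, adj', (isIso_mateEquiv_iff α adj adj').2 fun a b' g =>
      (Factorization.hasTerminal_iff adj').1 (h a b' g)⟩

lemma isLeftAdjoint_structuredArrowDownwards_iff (a : A) :
    (α.structuredArrowDownwards a).IsLeftAdjoint ↔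
      ∀ (b' : B') (g : u.obj a ⟶ w.obj b'), Limits.HasTerminal (Factorization α g) := by
  rw [isLeftAdjoint_iff_hasTerminal_costructuredArrow]
  let e {b' : B'} (g : u.obj a ⟶ w.obj b') :
      Factorization α g ≌ α.CostructuredArrowDownwards g :=
    (Factorization.equivalenceStructuredArrow α g).trans (α.equivalenceJ g)
  constructor
  · intro h b' g
    have := h (StructuredArrow.mk g)
    exact hasTerminal_of_equivalence (e g).symm
  · intro h X
    obtain ⟨b', g, rfl⟩ := X.mk_surjective
    have := h b' g
    exact hasTerminal_of_equivalence (e g)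

end Square

end ExactSquares

theorem mainTheorem5 {A A' B B' : Type w} [SmallCategory A] [SmallCategory A'] [SmallCategory B]
    [SmallCategory B'] (u : A ⥤ B) (u' : A' ⥤ B') (v : A' ⥤ A) (w : B' ⥤ B)
    (α : TwoSquare v u' u w) (hu : u.IsLeftAdjoint) (hu' : u'.IsLeftAdjoint) :
    List.TFAE [
      ExactSquares.IsLeftBeckChevalley α,
      ExactSquares.IsExact ExactSquares.WInf.{w} α,
      ExactSquares.IsExact ExactSquares.WZero.{w} α,
      ∀ a : A, (α.structuredArrowDownwards a).IsLeftAdjoint,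
      ∀ (a : A) (b' : B') (g : u.obj a ⟶ w.obj b'),
        Limits.HasTerminal (ExactSquares.Factorization α g)] := by
  tfae_have 1 ↔ 5 := ExactSquares.isLeftBeckChevalley_iff hu hu'
  tfae_have 5 → 2 := ExactSquares.isExact_wInf_of_hasTerminal hu
  tfae_have 2 → 3 := ExactSquares.IsExact.mono ExactSquares.WInf_le_WZero
  tfae_have 3 → 5 := ExactSquares.hasTerminal_of_isExact_wZero hu hu'
  tfae_have 4 ↔ 5 := forall_congr' ExactSquares.isLeftAdjoint_structuredArrowDownwards_iff
  tfae_finish
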